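/- Let $\mu$ be the unique Borel probability measure on $\mathbb R$ with $\mu(E)=\frac12\left(\mu(\tau_0^{-1}E)+\mu(\tau_2^{-1}E)\right)$ for all Borel sets $E$, where $\tau_0(x)=x/4$ and $\tau_2(x)=(x+2)/4$. For an odd natural number $m$ put $$\Gamma(m)=\left\{\sum_{k=0}^n 4^k l_k : n\ge 0,\ l_k\in\{0,m\}\right\}.$$ Call $m$ complete if the exponentials $x\mapsto e^{2\pi i\lambda x}$, $\lambda\in\Gamma(m)$, form an orthonormal basis of $L^2(\mu)$, and incomplete otherwise. Call an odd natural number $m$ primitive if $m$ is incomplete and every proper divisor $d$ of $m$ (that is, $d\mid m$ and $d<m$) is complete. Let $o_4(m)$ denote the order of $4$ in the group of units of $\mathbb Z/m\mathbb Z$. Theorem. Let $m$ be an odd natural number such that $$o_4(m)>\min_{n\ge 0}\left\{2^n\left\lceil\frac{m}{3\cdot 4^n}\right\rceil\right\}.$$ Then $m$ is not primitive. If moreover every proper divisor of $m$ is complete, then $m$ is complete. -/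

import Mathlib

open MeasureTheory
open scoped ENNReal

noncomputable section

namespace CantorFour

/-- The fair coin: each of the two Booleans has probability `1 / 2`. -/
def coin : Measure Bool := (PMF.uniformOfFintype Bool).toMeasure

instance : IsProbabilityMeasure coin := by unfold coin; infer_instance

/-- The point `∑ₖ bₖ 4⁻ᵏ` (`k ≥ 1`) of the quarter Cantor set whose base 4 digits `bₖ ∈ {0, 2}` are
given by a sequence of Booleans. -/
def code (ω : ℕ → Bool) : ℝ := ∑' k : ℕ, (if ω k then (2 : ℝ) else 0) / 4 ^ (k + 1)

/-- The invariant probability measure `μ` on the quarter Cantor set: the law of `∑ₖ bₖ 4⁻ᵏ`,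
where the digits `bₖ` are independent and uniform on `{0, 2}`. Lemma `isInvariant_iff` below
shows that it is the unique Borel probability measure with
`μ(E) = (μ(τ₀⁻¹ E) + μ(τ₂⁻¹ E)) / 2`. -/
def cantorMeasure : Measure ℝ := (Measure.infinitePi fun _ : ℕ => coin).map code

/-- Invariance under the iterated function system `τ₀ x = x / 4`, `τ₂ x = (x + 2) / 4`. -/
def IsInvariant (ν : Measure ℝ) : Prop :=
  ∀ E : Set ℝ, MeasurableSet E →
    ν E = 2⁻¹ * (ν ((fun x : ℝ => x / 4) ⁻¹' E) + ν ((fun x : ℝ => (x + 2) / 4) ⁻¹' E))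

lemma summable_code (ω : ℕ → Bool) :
    Summable fun k : ℕ => (if ω k then (2 : ℝ) else 0) / 4 ^ (k + 1) := by
  refine Summable.of_nonneg_of_le (fun k => by positivity) (fun k => ?_)
    ((summable_geometric_of_lt_one (r := (1 / 4 : ℝ)) (by norm_num) (by norm_num)).mul_left 2)
  have h4 : (0 : ℝ) < 4 ^ k := by positivity
  rw [one_div, inv_pow, ← div_eq_mul_inv, pow_succ]
  refine div_le_div₀ (by norm_num) (by split_ifs <;> norm_num) h4 (by linarith)

lemma measurable_code : Measurable code := by
  unfold code
  refine Measurable.tsum (fun k => ?_)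
  have : Measurable fun b : Bool => (if b then (2 : ℝ) else 0) / 4 ^ (k + 1) := measurable_of_finite _
  exact this.comp (measurable_pi_apply k)

instance : IsProbabilityMeasure cantorMeasure :=
  Measure.isProbabilityMeasure_map measurable_code.aemeasurable

/-- Prepend a digit. -/
def cons (b : Bool) (ω : ℕ → Bool) : ℕ → Bool := fun k => match k with
  | 0 => b
  | k + 1 => ω k

lemma measurable_cons (b : Bool) : Measurable (cons b) := by
  refine measurable_pi_lambda _ (fun k => ?_)
  cases k with
  | zero => exact measurable_const
  | succ k => exact measurable_pi_apply k

lemma code_cons (b : Bool) (ω : ℕ → Bool) :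
    code (cons b ω) = (code ω + if b then 2 else 0) / 4 := by
  unfold code
  rw [(summable_code (cons b ω)).tsum_eq_zero_add, add_div, ← tsum_div_const, add_comm]
  congr 1
  · refine tsum_congr (fun k => ?_)
    simp only [cons]
    rw [div_div, ← pow_succ]
    rfl
  · simp only [zero_add, pow_one]
    rfl

lemma coin_apply (t : Set Bool) :
    coin t = 2⁻¹ * t.indicator 1 false + 2⁻¹ * t.indicator 1 true := by
  unfold coin
  rw [PMF.toMeasure_apply_fintype]
  simp only [Fintype.sum_bool, Set.indicator, PMF.uniformOfFintype_apply, Fintype.card_bool,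
    Nat.cast_ofNat, Pi.one_apply]
  rw [add_comm]
  congr 1 <;> split_ifs <;> simp

lemma infinitePi_coin :
    (2⁻¹ : ℝ≥0∞) • (Measure.infinitePi fun _ : ℕ => coin).map (cons false) +
      (2⁻¹ : ℝ≥0∞) • (Measure.infinitePi fun _ : ℕ => coin).map (cons true) =
      Measure.infinitePi fun _ : ℕ => coin := by
  refine Measure.eq_infinitePi _ (fun s t ht => ?_)
  obtain ⟨N, hN⟩ : ∃ N, s ⊆ Finset.range (N + 1) :=
    ⟨s.sup id, fun i hi => Finset.mem_range.2 (Nat.lt_succ_of_le (Finset.le_sup (f := id) hi))⟩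
  classical
  set t' : ℕ → Set Bool := fun i => if i ∈ s then t i else Set.univ with ht'
  have hmeas : ∀ i, MeasurableSet (t' i) := fun i => Set.Finite.measurableSet (Set.toFinite _)
  have hpi : Set.pi (s : Set ℕ) t = Set.pi (Finset.range (N + 1) : Set ℕ) t' := by
    ext ω
    simp only [Set.mem_pi, Finset.mem_coe, ht']
    constructor
    · intro h i _
      split_ifs with hi
      · exact h i hi
      · trivial
    · intro h i hi
      simpa [hi] using h i (hN hi)
  have hprod : ∏ i ∈ s, coin (t i) = ∏ i ∈ Finset.range (N + 1), coin (t' i) := by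
    rw [← Finset.prod_subset hN]
    · exact Finset.prod_congr rfl (fun i hi => by simp [ht', hi])
    · intro i _ hi
      simp only [ht', if_neg hi, measure_univ]
  have hcons : ∀ b : Bool, (Measure.infinitePi fun _ : ℕ => coin).map (cons b)
      (Set.pi (Finset.range (N + 1) : Set ℕ) t') =
      (t' 0).indicator 1 b * ∏ i ∈ Finset.range N, coin (t' (i + 1)) := by
    intro b
    rw [Measure.map_apply (measurable_cons b)
      (MeasurableSet.pi (Set.to_countable _) (fun i _ => hmeas i))]
    by_cases hb : b ∈ t' 0
    · have : cons b ⁻¹' (Set.pi (Finset.range (N + 1) : Set ℕ) t') =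
          Set.pi (Finset.range N : Set ℕ) (fun i => t' (i + 1)) := by
        ext ω
        simp only [Set.mem_preimage, Set.mem_pi, Finset.mem_coe, Finset.mem_range]
        constructor
        · intro h i hi
          exact h (i + 1) (by omega)
        · intro h i hi
          cases i with
          | zero => exact hb
          | succ i => exact h i (by omega)
      rw [this, Measure.infinitePi_pi _ (fun i _ => hmeas _)]
      simp [hb]
    · have : cons b ⁻¹' (Set.pi (Finset.range (N + 1) : Set ℕ) t') = ∅ := by
        ext ω
        simp only [Set.mem_preimage, Set.mem_pi, Finset.mem_coe, Finset.mem_range,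
          Set.mem_empty_iff_false, iff_false]
        exact fun h => hb (h 0 (by omega))
      rw [this]
      simp [hb]
  rw [hpi, hprod, Finset.prod_range_succ']
  simp only [Measure.add_apply, Measure.smul_apply, smul_eq_mul, hcons]
  rw [coin_apply (t' 0)]
  ring

lemma cantorMeasure_isInvariant : IsInvariant cantorMeasure := by
  intro E hE
  have h0 : Measurable fun x : ℝ => x / 4 := by fun_prop
  have h2 : Measurable fun x : ℝ => (x + 2) / 4 := by fun_prop
  unfold cantorMeasure
  rw [Measure.map_apply measurable_code hE, Measure.map_apply measurable_code (h0 hE),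
    Measure.map_apply measurable_code (h2 hE)]
  conv_lhs => rw [← infinitePi_coin]
  simp only [Measure.add_apply, Measure.smul_apply, smul_eq_mul]
  rw [Measure.map_apply (measurable_cons _) (measurable_code hE),
    Measure.map_apply (measurable_cons _) (measurable_code hE), mul_add]
  congr 3
  · ext ω
    simp [code_cons]
  · ext ω
    simp [code_cons]

lemma IsInvariant.eq_map {ν : Measure ℝ} (h : IsInvariant ν) :
    ν = (2⁻¹ : ℝ≥0∞) • ν.map (fun x : ℝ => x / 4) +
      (2⁻¹ : ℝ≥0∞) • ν.map (fun x : ℝ => (x + 2) / 4) := by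
  ext E hE
  simp only [Measure.add_apply, Measure.smul_apply, smul_eq_mul]
  rw [Measure.map_apply (by fun_prop) hE, Measure.map_apply (by fun_prop) hE, ← mul_add]
  exact h E hE

lemma IsInvariant.charFun_eq {ν : Measure ℝ} [IsProbabilityMeasure ν] (h : IsInvariant ν) (t : ℝ) :
    charFun ν t = (1 + Complex.exp ((t / 2 : ℝ) * Complex.I)) / 2 * charFun ν (t / 4) := by
  have hint : ∀ g : ℝ → ℝ, Measurable g →
      Integrable (fun x : ℝ => Complex.exp (t * x * Complex.I)) (ν.map g) := by
    intro g hg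
    have : IsProbabilityMeasure (ν.map g) := Measure.isProbabilityMeasure_map hg.aemeasurable
    refine Integrable.of_bound (C := 1) (by fun_prop) (Filter.Eventually.of_forall fun x => ?_)
    rw [← Complex.ofReal_mul, Complex.norm_exp_ofReal_mul_I]
  have hne : (2⁻¹ : ℝ≥0∞) ≠ ∞ := by simp
  have e0 : ∫ x, Complex.exp (t * x * Complex.I) ∂ν.map (fun x : ℝ => x / 4) =
      charFun ν (t / 4) := by
    rw [integral_map (by fun_prop) (by fun_prop), charFun_apply_real]
    refine integral_congr_ae (Filter.Eventually.of_forall fun x => ?_)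
    simp only
    congr 1
    push_cast
    ring
  have e2 : ∫ x, Complex.exp (t * x * Complex.I) ∂ν.map (fun x : ℝ => (x + 2) / 4) =
      Complex.exp ((t / 2 : ℝ) * Complex.I) * charFun ν (t / 4) := by
    rw [integral_map (by fun_prop) (by fun_prop), charFun_apply_real, ← integral_const_mul]
    refine integral_congr_ae (Filter.Eventually.of_forall fun x => ?_)
    simp only
    rw [← Complex.exp_add]
    congr 1
    push_cast
    ring
  rw [charFun_apply_real]
  conv_lhs => rw [h.eq_map]
  rw [integral_add_measure ((hint _ (by fun_prop)).smul_measure hne)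
    ((hint _ (by fun_prop)).smul_measure hne), integral_smul_measure, integral_smul_measure, e0, e2]
  simp only [ENNReal.toReal_inv, ENNReal.toReal_ofNat, Complex.real_smul]
  push_cast
  ring

/-- `cantorMeasure` is the unique Borel probability measure that is invariant. -/
lemma isInvariant_iff {ν : Measure ℝ} [IsProbabilityMeasure ν] :
    IsInvariant ν ↔ ν = cantorMeasure := by
  refine ⟨fun h => ?_, fun h => h ▸ cantorMeasure_isInvariant⟩
  refine Measure.ext_of_charFun (funext fun t => ?_)
  set d : ℝ → ℝ := fun t => ‖charFun ν t - charFun cantorMeasure t‖ with hd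
  have step : ∀ t, d t ≤ d (t / 4) := by
    intro t
    simp only [hd]
    rw [h.charFun_eq t, cantorMeasure_isInvariant.charFun_eq t, ← mul_sub, norm_mul]
    refine mul_le_of_le_one_left (norm_nonneg _) ?_
    rw [norm_div, Complex.norm_ofNat]
    have := norm_add_le (1 : ℂ) (Complex.exp ((t / 2 : ℝ) * Complex.I))
    rw [Complex.norm_exp_ofReal_mul_I, norm_one] at this
    linarith
  have steps : ∀ n : ℕ, d t ≤ d (t * (1 / 4) ^ n) := by
    intro n
    induction n with
    | zero => simp
    | succ n ih =>
      refine ih.trans ((step _).trans (le_of_eq ?_))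
      congr 1
      ring
  have hcont : Continuous d := (continuous_charFun.sub continuous_charFun).norm
  have hlim : Filter.Tendsto (fun n : ℕ => d (t * (1 / 4) ^ n)) Filter.atTop (nhds 0) := by
    have h1 : Filter.Tendsto (fun n : ℕ => t * (1 / 4 : ℝ) ^ n) Filter.atTop (nhds 0) := by
      simpa using (tendsto_pow_atTop_nhds_zero_of_lt_one (r := (1 / 4 : ℝ))
        (by norm_num) (by norm_num)).const_mul t
    have h2 := (hcont.tendsto 0).comp h1
    have h3 : d 0 = 0 := by simp [hd]
    rwa [h3] at h2
  have : d t ≤ 0 := ge_of_tendsto' hlim steps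
  exact sub_eq_zero.1 (norm_le_zero_iff.1 this)

/-- The exponential function `e_lam(x) = exp(2 π i lam x)`. -/
def expFun (lam : ℝ) (x : ℝ) : ℂ := Complex.exp (2 * Real.pi * Complex.I * lam * x)

lemma memLp_expFun (ν : Measure ℝ) [IsFiniteMeasure ν] (lam : ℝ) : MemLp (expFun lam) 2 ν := by
  refine MemLp.of_bound (C := 1) (by unfold expFun; fun_prop)
    (Filter.Eventually.of_forall fun x => ?_)
  have : (2 * Real.pi * Complex.I * lam * x : ℂ) = ((2 * Real.pi * lam * x : ℝ) : ℂ) * Complex.I := by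
    push_cast
    ring
  rw [expFun, this, Complex.norm_exp_ofReal_mul_I]

/-- The exponential function `e_lam` as an element of `L²(ν)`. -/
def expL2 (ν : Measure ℝ) [IsFiniteMeasure ν] (lam : ℝ) : Lp ℂ 2 ν := (memLp_expFun ν lam).toLp

/-- `Γ` is a spectrum for `ν` if the family `e_lam`, `lam ∈ Γ`, is an orthonormal basis (that is,
an orthonormal family with dense linear span) of `L²(ν)`. -/
def IsSpectrum (ν : Measure ℝ) [IsFiniteMeasure ν] (Γ : Set ℝ) : Prop :=
  Orthonormal ℂ (fun lam : Γ => expL2 ν lam) ∧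
    (Submodule.span ℂ (Set.range fun lam : Γ => expL2 ν lam)).topologicalClosure = ⊤

/-- `Γ(m) = {∑_{k=0}^n 4^k l_k : l_k ∈ {0, m}, n ∈ ℕ}`. -/
def digitSet (m : ℕ) : Set ℝ :=
  {x | ∃ (n : ℕ) (l : ℕ → ℝ), (∀ k, l k = 0 ∨ l k = m) ∧
    x = ∑ k ∈ Finset.range (n + 1), 4 ^ k * l k}

/-- The (odd) number `m` is complete if `Γ(m)` is a spectrum for the measure `μ`. -/
def IsComplete (m : ℕ) : Prop := IsSpectrum cantorMeasure (digitSet m)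

/-- The number `m` is primitive if it is odd and incomplete and all its proper divisors are
complete. -/
def IsPrimitive (m : ℕ) : Prop :=
  Odd m ∧ ¬ IsComplete m ∧ ∀ d : ℕ, d ∣ m → d < m → IsComplete d

end CantorFour

end

/-! Completeness is decided by the integer dynamics of x ↦ x/4, x ↦ (x + m)/4: an odd m is
incomplete exactly when these maps have an infinite orbit of positive integers in [0, m/3]
(`isComplete_iff`). Such an orbit, started at x₀, makes the exponential of frequency -x₀ orthogonal
to the whole family, so the family is not total. Conversely, the Parseval sum of exponentials
dominates a weighted average of its values at t/4 and (t + m)/4. If it fell below 1 somewhere, it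
would have a minimum below 1 on a compact interval mapped into itself by both maps. All minimisers
there are integers, and following children of positive weight yields an orbit (`one_le_parsevalSum`,
`hasIntegerOrbit_of_forall_exists`). Suppose m is incomplete and all its proper divisors are
complete. The gcd with m is constant along an orbit, and dividing by it gives an orbit for a proper
divisor unless it is 1. So the points are units mod m, and since x_i ≡ 4 x_{i+1} mod m, any o₄(m)
consecutive ones are distinct. After n steps they lie in at most 2^n intervals of length m/(3·4^n),
whence o₄(m) ≤ 2^n⌈m/(3·4^n)⌉ for every n (`HasIntegerOrbit.orderOf_le`), against the hypothesis. -/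

namespace CantorFour

/-! ### Totality of exponentials, and spectra via Parseval. -/

/-- A real integrable function whose Fourier transform vanishes is zero almost everywhere. -/
lemma ae_eq_zero_of_integral_exp_mul_ofReal {ν : Measure ℝ} [IsFiniteMeasure ν] {g : ℝ → ℝ}
    (hg : Integrable g ν)
    (h : ∀ t : ℝ, ∫ x, Complex.exp (t * x * Complex.I) * (g x : ℂ) ∂ν = 0) : g =ᵐ[ν] 0 := by
  have hpos : ∀ f : ℝ → ℝ, Integrable f ν →
      IsFiniteMeasure (ν.withDensity fun x => ENNReal.ofReal (f x)) := fun f hf =>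
    isFiniteMeasure_withDensity_ofReal hf.2
  have hchar : ∀ f : ℝ → ℝ, Integrable f ν → ∀ t : ℝ,
      charFun (ν.withDensity fun x => ENNReal.ofReal (f x)) t =
        ∫ x, Complex.exp (t * x * Complex.I) * ((max (f x) 0 : ℝ) : ℂ) ∂ν := by
    intro f hf t
    rw [charFun_apply_real, integral_withDensity_eq_integral_toReal_smul₀
      hf.1.aemeasurable.ennreal_ofReal (Filter.Eventually.of_forall fun x => ENNReal.ofReal_lt_top)]
    refine integral_congr_ae (Filter.Eventually.of_forall fun x => ?_)
    simp only [ENNReal.toReal_ofReal', Complex.real_smul]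
    ring
  have hint : ∀ f : ℝ → ℝ, Integrable f ν → ∀ t : ℝ,
      Integrable (fun x : ℝ => Complex.exp (t * x * Complex.I) * ((max (f x) 0 : ℝ) : ℂ)) ν := by
    intro f hf t
    refine (hf.pos_part.ofReal (𝕜 := ℂ)).bdd_mul (c := 1) (by fun_prop)
      (Filter.Eventually.of_forall fun x => ?_)
    rw [← Complex.ofReal_mul, Complex.norm_exp_ofReal_mul_I]
  have := hpos g hg
  have hneg : Integrable (fun x => -g x) ν := hg.neg
  have := hpos _ hneg
  -- The positive and negative parts of g are densities of two finite measures whose characteristic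
  -- functions differ by the Fourier transform of g, which is 0.
  have heq : (ν.withDensity fun x => ENNReal.ofReal (g x)) =
      ν.withDensity fun x => ENNReal.ofReal (-g x) := by
    refine Measure.ext_of_charFun (funext fun t => ?_)
    rw [hchar g hg, hchar _ hneg, ← sub_eq_zero, ← integral_sub (hint g hg t) (hint _ hneg t),
      ← h t]
    refine integral_congr_ae (Filter.Eventually.of_forall fun x => ?_)
    simp only
    rw [← mul_sub, ← Complex.ofReal_sub, max_comm (g x), max_comm (-g x)]
    congr 2
    rcases le_total 0 (g x) with hx | hx
    · rw [max_eq_right hx, max_eq_left (by linarith), sub_zero]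
    · rw [max_eq_left hx, max_eq_right (by linarith)]; ring
  rw [withDensity_eq_iff_of_sigmaFinite hg.1.aemeasurable.ennreal_ofReal
    hneg.1.aemeasurable.ennreal_ofReal] at heq
  -- At each point one of the two parts vanishes, so their equality forces g to vanish.
  filter_upwards [heq] with x hx
  rcases le_total 0 (g x) with h0 | h0
  · rw [ENNReal.ofReal_of_nonpos (p := -g x) (by linarith), ENNReal.ofReal_eq_zero] at hx
    exact le_antisymm hx h0
  · rw [ENNReal.ofReal_of_nonpos h0, eq_comm, ENNReal.ofReal_eq_zero] at hx
    exact le_antisymm h0 (neg_nonpos.1 hx)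

/-- A complex integrable function whose Fourier transform vanishes is zero almost everywhere. -/
lemma ae_eq_zero_of_integral_exp_mul {ν : Measure ℝ} [IsFiniteMeasure ν] {f : ℝ → ℂ}
    (hf : Integrable f ν) (h : ∀ t : ℝ, ∫ x, Complex.exp (t * x * Complex.I) * f x ∂ν = 0) :
    f =ᵐ[ν] 0 := by
  have hint : ∀ k : ℝ → ℂ, Integrable k ν → ∀ t : ℝ,
      Integrable (fun x : ℝ => Complex.exp (t * x * Complex.I) * k x) ν := by
    intro k hk t
    refine hk.bdd_mul (c := 1) (by fun_prop) (Filter.Eventually.of_forall fun x => ?_)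
    rw [← Complex.ofReal_mul, Complex.norm_exp_ofReal_mul_I]
  have hfc : Integrable (fun x => (starRingEnd ℂ) (f x)) ν :=
    (LinearIsometryEquiv.integrable_comp_iff (RCLike.conjLIE (K := ℂ))).2 hf
  -- Conjugation turns the transform at -t into that of the conjugate at t; hence the real and
  -- imaginary parts also have vanishing transform.
  have hconj : ∀ t : ℝ,
      ∫ x, Complex.exp (t * x * Complex.I) * (starRingEnd ℂ) (f x) ∂ν = 0 := by
    intro t
    have h1 := congrArg (starRingEnd ℂ) (h (-t))
    rw [← integral_conj, map_zero] at h1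
    rw [← h1]
    refine integral_congr_ae (Filter.Eventually.of_forall fun x => ?_)
    simp only [map_mul, ← Complex.exp_conj, Complex.conj_ofReal, Complex.conj_I]
    congr 2
    push_cast
    ring
  have hre := ae_eq_zero_of_integral_exp_mul_ofReal hf.re (fun t => by
    have h1 : ∫ x, (Complex.exp (t * x * Complex.I) * f x +
        Complex.exp (t * x * Complex.I) * (starRingEnd ℂ) (f x)) / 2 ∂ν = 0 := by
      rw [integral_div, integral_add (hint f hf t) (hint _ hfc t), h t, hconj t]
      simp
    rw [← h1]
    refine integral_congr_ae (Filter.Eventually.of_forall fun x => ?_)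
    simp only [← mul_add, Complex.add_conj]
    push_cast
    simp
    ring)
  have him := ae_eq_zero_of_integral_exp_mul_ofReal hf.im (fun t => by
    have h1 : ∫ x, (Complex.exp (t * x * Complex.I) * f x -
        Complex.exp (t * x * Complex.I) * (starRingEnd ℂ) (f x)) / (2 * Complex.I) ∂ν = 0 := by
      rw [integral_div, integral_sub (hint f hf t) (hint _ hfc t), h t, hconj t]
      simp
    rw [← h1]
    refine integral_congr_ae (Filter.Eventually.of_forall fun x => ?_)
    simp only [← mul_sub, Complex.sub_conj]
    push_cast
    simp
    field_simp)
  filter_upwards [hre, him] with x hx hy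
  exact Complex.ext hx hy

lemma inner_expL2 (ν : Measure ℝ) [IsFiniteMeasure ν] (a b : ℝ) :
    inner ℂ (expL2 ν a) (expL2 ν b) = charFun ν (2 * Real.pi * (b - a)) := by
  rw [L2.inner_def, charFun_apply_real]
  refine integral_congr_ae ?_
  filter_upwards [(memLp_expFun ν a).coeFn_toLp, (memLp_expFun ν b).coeFn_toLp] with x hx hy
  rw [expL2, expL2, hx, hy, RCLike.inner_apply, expFun, expFun, ← Complex.exp_conj, ← Complex.exp_add]
  congr 1
  simp only [map_mul, Complex.conj_ofReal, Complex.conj_I, Complex.conj_ofNat]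
  push_cast
  ring

lemma norm_expL2 (ν : Measure ℝ) [IsProbabilityMeasure ν] (a : ℝ) : ‖expL2 ν a‖ = 1 := by
  have h := inner_self_eq_norm_sq_to_K (𝕜 := ℂ) (expL2 ν a)
  rw [inner_expL2, sub_self, mul_zero, charFun_zero, probReal_univ] at h
  have h2 : ‖expL2 ν a‖ ^ 2 = 1 := Complex.ofReal_injective (by simpa using h.symm)
  nlinarith [norm_nonneg (expL2 ν a)]

/-- The exponential functions are total in `L²(ν)`. -/
lemma eq_zero_of_forall_inner_expL2 (ν : Measure ℝ) [IsFiniteMeasure ν] (f : Lp ℂ 2 ν)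
    (h : ∀ t : ℝ, inner ℂ (expL2 ν t) f = 0) : f = 0 := by
  rw [Lp.eq_zero_iff_ae_eq_zero]
  refine ae_eq_zero_of_integral_exp_mul ((Lp.memLp f).integrable (by norm_num)) fun t => ?_
  rw [← h (-t / (2 * Real.pi)), L2.inner_def]
  refine integral_congr_ae ?_
  filter_upwards [(memLp_expFun ν (-t / (2 * Real.pi))).coeFn_toLp] with x hx
  rw [expL2, hx, RCLike.inner_apply, expFun, ← Complex.exp_conj, mul_comm (f x)]
  congr 2
  have : (Real.pi : ℂ) ≠ 0 := by exact_mod_cast Real.pi_ne_zero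
  simp only [map_mul, Complex.conj_ofReal, Complex.conj_I, Complex.conj_ofNat]
  push_cast
  field_simp

/-- An orthonormal family of exponentials is a spectrum as soon as Parseval's identity holds for
all exponentials. -/
lemma isSpectrum_of_one_le_tsum {ν : Measure ℝ} [IsProbabilityMeasure ν] {Γ : Set ℝ}
    (ho : Orthonormal ℂ (fun lam : Γ => expL2 ν lam))
    (h : ∀ t : ℝ, 1 ≤ ∑' lam : Γ, ENNReal.ofReal (‖charFun ν (2 * Real.pi * (t + lam))‖ ^ 2)) :
    IsSpectrum ν Γ := by
  refine ⟨ho, ?_⟩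
  set K := (Submodule.span ℂ (Set.range fun lam : Γ => expL2 ν lam)).topologicalClosure with hK
  have hmem : ∀ lam : Γ, expL2 ν lam ∈ K := fun lam =>
    Submodule.le_topologicalClosure _ (Submodule.subset_span ⟨lam, rfl⟩)
  have : CompleteSpace K :=
    (Submodule.isClosed_topologicalClosure _).completeSpace_coe
  have hexp : ∀ t : ℝ, expL2 ν t ∈ K := by
    intro t
    set p := K.starProjection (expL2 ν t) with hp
    have hin : ∀ lam : Γ, ‖inner ℂ (expL2 ν lam) p‖ = ‖charFun ν (2 * Real.pi * (-t + lam))‖ := by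
      intro lam
      rw [hp, ← Submodule.inner_starProjection_left_eq_right,
        Submodule.starProjection_eq_self_iff.2 (hmem lam), inner_expL2, ← RCLike.norm_conj,
        ← charFun_neg]
      congr 2
      ring
    -- The projection p has the same coefficients as the exponential. Bessel bounds their sum by
    -- ‖p‖², the hypothesis makes it at least 1, and Pythagoras then leaves nothing for the
    -- orthogonal part.
    have hb := ho.tsum_inner_products_le p
    have hs := ho.inner_products_summable p
    have h1 := h (-t)
    simp_rw [← hin] at h1
    rw [← ENNReal.ofReal_tsum_of_nonneg (fun _ => by positivity) hs, ENNReal.one_le_ofReal] at h1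
    have h2 : ‖expL2 ν t‖ ^ 2 = ‖p‖ ^ 2 + ‖expL2 ν t - p‖ ^ 2 := by
      have hz : inner ℂ p (expL2 ν t - p) = 0 := by
        rw [← inner_conj_symm, hp,
          Submodule.starProjection_inner_eq_zero _ _ (Submodule.starProjection_apply_mem _ _),
          map_zero]
      have := norm_add_sq_eq_norm_sq_add_norm_sq_of_inner_eq_zero p (expL2 ν t - p) hz
      rw [add_sub_cancel] at this
      simpa only [sq] using this
    rw [norm_expL2] at h2
    have h3 : expL2 ν t - p = 0 := by
      rw [← norm_eq_zero, ← sq_eq_zero_iff]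
      nlinarith [sq_nonneg ‖expL2 ν t - p‖]
    rw [sub_eq_zero] at h3
    rw [h3]
    exact Submodule.starProjection_apply_mem _ _
  have hcl : K.topologicalClosure = ⊤ := by
    rw [Submodule.topologicalClosure_eq_top_iff, Submodule.eq_bot_iff]
    exact fun f hf => eq_zero_of_forall_inner_expL2 ν f fun t => hf _ (hexp t)
  rwa [(Submodule.isClosed_topologicalClosure _).submodule_topologicalClosure_eq] at hcl

/-- A spectrum is maximal: no exponential is orthogonal to all its members. -/
lemma IsSpectrum.exists_charFun_ne_zero {ν : Measure ℝ} [IsProbabilityMeasure ν] {Γ : Set ℝ}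
    (h : IsSpectrum ν Γ) (t : ℝ) : ∃ lam ∈ Γ, charFun ν (2 * Real.pi * (t + lam)) ≠ 0 := by
  by_contra! hc
  have h1 := (Submodule.topologicalClosure_eq_top_iff).1 h.2
  have h2 : expL2 ν (-t) ∈ (Submodule.span ℂ (Set.range fun lam : Γ => expL2 ν lam))ᗮ := by
    rw [Submodule.mem_orthogonal']
    intro u hu
    induction hu using Submodule.span_induction with
    | mem u hu =>
      obtain ⟨lam, rfl⟩ := hu
      rw [inner_expL2, ← hc lam lam.2]
      congr 2
      ring
    | zero => exact inner_zero_right _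
    | add u v _ _ hu hv => rw [inner_add_right, hu, hv, add_zero]
    | smul a u _ hu => rw [inner_smul_right, hu, mul_zero]
  rw [h1, Submodule.mem_bot] at h2
  have h3 := norm_expL2 ν (-t)
  rw [h2, norm_zero] at h3
  exact zero_ne_one h3

/-! The Fourier transform of the measure. -/

/-- In this normalisation the first factor vanishes exactly at the odd integers. So odd integers are
zeros of the transform, and its zeros are stable under multiplication by 4; every orthogonality
below comes from these two facts. -/
lemma charFun_cantorMeasure (t : ℝ) : charFun cantorMeasure (2 * Real.pi * t) =
    (1 + Complex.exp ((Real.pi * t : ℝ) * Complex.I)) / 2 *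
      charFun cantorMeasure (2 * Real.pi * (t / 4)) := by
  rw [cantorMeasure_isInvariant.charFun_eq]
  congr 3 <;> ring_nf

lemma exp_pi_mul_add_two_mul (t : ℝ) (k : ℕ) :
    Complex.exp ((Real.pi * (t + 2 * k) : ℝ) * Complex.I) =
      Complex.exp ((Real.pi * t : ℝ) * Complex.I) := by
  have : ((Real.pi * (t + 2 * k) : ℝ) * Complex.I : ℂ) =
      (Real.pi * t : ℝ) * Complex.I + (k : ℕ) * (2 * Real.pi * Complex.I) := by
    push_cast
    ring
  rw [this, Complex.exp_add, Complex.exp_nat_mul_two_pi_mul_I, mul_one]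

lemma exp_pi_mul_add_odd (t : ℝ) {m : ℕ} (hm : Odd m) :
    Complex.exp ((Real.pi * (t + m) : ℝ) * Complex.I) =
      -Complex.exp ((Real.pi * t : ℝ) * Complex.I) := by
  obtain ⟨k, rfl⟩ := hm
  have : t + ((2 * k + 1 : ℕ) : ℝ) = (t + 1) + 2 * k := by push_cast; ring
  rw [this, exp_pi_mul_add_two_mul, mul_add, mul_one, Complex.ofReal_add, add_mul, Complex.exp_add,
    Complex.exp_pi_mul_I]
  ring

lemma exp_pi_mul_odd_int {z : ℤ} (hz : Odd z) :
    Complex.exp ((Real.pi * z : ℝ) * Complex.I) = -1 := by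
  obtain ⟨k, rfl⟩ := hz
  have : ((Real.pi * ((2 * k + 1 : ℤ) : ℝ) : ℝ) * Complex.I : ℂ) =
      k * (2 * Real.pi * Complex.I) + Real.pi * Complex.I := by
    push_cast
    ring
  rw [this, Complex.exp_add, Complex.exp_int_mul_two_pi_mul_I, Complex.exp_pi_mul_I, one_mul]

lemma exists_int_of_exp_pi_mul_eq {t : ℝ} (h : 1 + Complex.exp ((Real.pi * t : ℝ) * Complex.I) = 0) :
    ∃ z : ℤ, (z : ℝ) = t := by
  rw [add_comm, add_eq_zero_iff_eq_neg, ← Complex.exp_pi_mul_I,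
    Complex.exp_eq_exp_iff_exists_int] at h
  obtain ⟨n, hn⟩ := h
  have h2 : (Real.pi * t : ℝ) * Complex.I = (Real.pi * (1 + 2 * n) : ℝ) * Complex.I := by
    rw [hn]
    push_cast
    ring
  have h3 := Complex.ofReal_injective (mul_right_cancel₀ Complex.I_ne_zero h2)
  refine ⟨1 + 2 * n, ?_⟩
  have := mul_left_cancel₀ Real.pi_ne_zero h3
  push_cast
  exact this.symm

lemma charFun_cantorMeasure_odd {z : ℤ} (hz : Odd z) :
    charFun cantorMeasure (2 * Real.pi * z) = 0 := by
  rw [charFun_cantorMeasure, exp_pi_mul_odd_int hz]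
  simp

lemma charFun_cantorMeasure_four_mul {t : ℝ} (h : charFun cantorMeasure (2 * Real.pi * t) = 0) :
    charFun cantorMeasure (2 * Real.pi * (4 * t)) = 0 := by
  rw [charFun_cantorMeasure, mul_div_cancel_left₀ t (by norm_num : (4 : ℝ) ≠ 0), h, mul_zero]

/-! The digit set. -/

/-- The natural numbers whose base 4 expansion has digits `0` and `m`. -/
inductive DigitNat (m : ℕ) : ℕ → Prop
  | zero : DigitNat m 0
  | four_mul {k : ℕ} : DigitNat m k → DigitNat m (4 * k)
  | four_mul_add {k : ℕ} : DigitNat m k → DigitNat m (4 * k + m)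

lemma DigitNat.exists_eq {m k : ℕ} (h : DigitNat m k) :
    ∃ j, DigitNat m j ∧ (k = 4 * j ∨ k = 4 * j + m) := by
  cases h with
  | zero => exact ⟨0, .zero, Or.inl rfl⟩
  | four_mul h => exact ⟨_, h, Or.inl rfl⟩
  | four_mul_add h => exact ⟨_, h, Or.inr rfl⟩

lemma mem_digitSet_iff {m : ℕ} {x : ℝ} : x ∈ digitSet m ↔ ∃ k : ℕ, DigitNat m k ∧ x = k := by
  constructor
  · rintro ⟨n, l, hl, rfl⟩
    -- Forgetting that the length is positive lets the induction start from the empty sum.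
    generalize n + 1 = N
    induction N generalizing l with
    | zero => exact ⟨0, .zero, by simp⟩
    | succ N ih =>
      obtain ⟨k, hk, he⟩ := ih (fun i => l (i + 1)) fun i => hl _
      have : ∑ i ∈ Finset.range (N + 1), (4 : ℝ) ^ i * l i = 4 * k + l 0 := by
        rw [Finset.sum_range_succ', ← he, Finset.mul_sum, pow_zero, one_mul]
        congr 1
        exact Finset.sum_congr rfl fun i _ => by ring
      rw [this]
      rcases hl 0 with h0 | h0
      · exact ⟨_, hk.four_mul, by rw [h0]; push_cast; ring⟩
      · exact ⟨_, hk.four_mul_add, by rw [h0]; push_cast; ring⟩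
  · rintro ⟨k, hk, rfl⟩
    have key : ∀ (n : ℕ) (l : ℕ → ℝ) (d : ℝ), (∀ k, l k = 0 ∨ l k = m) → (d = 0 ∨ d = m) →
        4 * ∑ k ∈ Finset.range (n + 1), 4 ^ k * l k + d ∈ digitSet m := by
      intro n l d hl hd
      refine ⟨n + 1, fun i => Nat.casesOn i d l, fun i => ?_, ?_⟩
      · cases i with
        | zero => exact hd
        | succ i => exact hl i
      · rw [Finset.sum_range_succ' _ (n + 1), Finset.mul_sum, pow_zero, one_mul]
        congr 1
        exact Finset.sum_congr rfl fun i _ => by simp only; ring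
    induction hk with
    | zero => exact ⟨0, fun _ => 0, fun _ => Or.inl rfl, by simp⟩
    | four_mul _ ih =>
      obtain ⟨n, l, hl, he⟩ := ih
      have := key n l 0 hl (Or.inl rfl)
      rw [← he] at this
      simpa using this
    | four_mul_add _ ih =>
      obtain ⟨n, l, hl, he⟩ := ih
      have := key n l m hl (Or.inr rfl)
      rw [← he] at this
      simpa using this

/-- Since m is odd, an even difference means equal lowest digits; these cancel, and a factor 4 can
be removed until the difference is odd. -/
lemma DigitNat.charFun_sub_eq_zero {m : ℕ} (hm : Odd m) {a b : ℕ} (ha : DigitNat m a)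
    (hb : DigitNat m b) (hab : a ≠ b) :
    charFun cantorMeasure (2 * Real.pi * ((a : ℝ) - b)) = 0 := by
  induction hN : a + b using Nat.strong_induction_on generalizing a b with
  | _ N ih =>
    obtain ⟨r, hr⟩ := hm
    have hcast : ((a : ℝ) - b) = ((a - b : ℤ) : ℝ) := by push_cast; ring
    obtain ⟨i, hi, hai⟩ := ha.exists_eq
    obtain ⟨j, hj, hbj⟩ := hb.exists_eq
    by_cases hpar : Odd ((a : ℤ) - b)
    · rw [hcast]
      exact charFun_cantorMeasure_odd hpar
    · have hd : (a : ℤ) - b = 4 * (i - j) := by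
        rw [Int.not_odd_iff_even, Int.even_iff] at hpar
        omega
      have hd' : (a : ℝ) - b = 4 * (i - j) := by exact_mod_cast hd
      rw [hd']
      exact charFun_cantorMeasure_four_mul (ih (i + j) (by omega) hi hj (by omega) rfl)

lemma orthonormal_digitSet {m : ℕ} (hm : Odd m) :
    Orthonormal ℂ (fun lam : digitSet m => expL2 cantorMeasure lam) := by
  refine ⟨fun _ => norm_expL2 _ _, fun x y hxy => ?_⟩
  obtain ⟨a, ha, hxa⟩ := mem_digitSet_iff.1 x.2
  obtain ⟨b, hb, hyb⟩ := mem_digitSet_iff.1 y.2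
  simp only
  rw [inner_expL2, hxa, hyb]
  refine hb.charFun_sub_eq_zero hm ha fun hab => hxy (Subtype.ext ?_)
  rw [hxa, hyb, hab]

/-! Integer orbits of the dual iterated function system. -/

/-- There is an infinite orbit of positive integers in `[0, m / 3]` under the dual iterated
function system `x ↦ x / 4`, `x ↦ (x + m) / 4`. -/
def HasIntegerOrbit (m : ℕ) : Prop :=
  ∃ x : ℕ → ℕ, ∀ i, 0 < x i ∧ 3 * x i ≤ m ∧ (4 * x (i + 1) = x i ∨ 4 * x (i + 1) = x i + m)

/-- Descent along the orbit and the digits of k together: if x_i + k is even, the multiples of m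
involved cancel and it equals 4(x_{i+1} + j). Positivity of the orbit makes the descent strict, so
it ends at an odd number, a zero of the transform. -/
lemma HasIntegerOrbit.not_isComplete {m : ℕ} (hm : Odd m) (h : HasIntegerOrbit m) :
    ¬ IsComplete m := by
  obtain ⟨x, hx⟩ := h
  have key : ∀ N i k, DigitNat m k → x i + k = N →
      charFun cantorMeasure (2 * Real.pi * (N : ℝ)) = 0 := by
    intro N
    induction N using Nat.strong_induction_on with
    | _ N ih =>
      intro i k hk hN
      obtain ⟨j, hj, hkj⟩ := hk.exists_eq
      obtain ⟨h0, -, h1⟩ := hx i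
      obtain ⟨r, hr⟩ := hm
      by_cases hpar : Odd N
      · exact_mod_cast charFun_cantorMeasure_odd (z := (N : ℤ)) (by exact_mod_cast hpar)
      · have hd : N = 4 * (x (i + 1) + j) := by
          rw [Nat.not_odd_iff_even, Nat.even_iff] at hpar
          omega
        rw [hd]
        push_cast
        have := ih (x (i + 1) + j) (by omega) (i + 1) j hj rfl
        push_cast at this
        exact charFun_cantorMeasure_four_mul this
  intro hc
  obtain ⟨lam, hlam, hne⟩ := hc.exists_charFun_ne_zero (x 0)
  obtain ⟨k, hk, rfl⟩ := mem_digitSet_iff.1 hlam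
  have := key _ 0 k hk rfl
  push_cast at this
  exact hne this

/-! The Parseval sum of an exponential. -/

/-- The sum of the squared moduli of the coefficients of an exponential in the family indexed by
`Γ(m)`. -/
noncomputable def parsevalSum (m : ℕ) (t : ℝ) : ℝ≥0∞ :=
  ∑' lam : digitSet m, ENNReal.ofReal (‖charFun cantorMeasure (2 * Real.pi * (t + lam))‖ ^ 2)

/-- The squared modulus of the mask function of the measure. -/
noncomputable def mask (t : ℝ) : ℝ≥0∞ :=
  ENNReal.ofReal (‖(1 + Complex.exp ((Real.pi * t : ℝ) * Complex.I)) / 2‖ ^ 2)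

lemma mask_add_mask {m : ℕ} (hm : Odd m) (t : ℝ) : mask t + mask (t + m) = 1 := by
  unfold mask
  rw [exp_pi_mul_add_odd t hm, ← ENNReal.ofReal_add (by positivity) (by positivity),
    ← ENNReal.ofReal_one]
  congr 1
  have h := parallelogram_law_with_norm ℝ (1 : ℂ) (Complex.exp ((Real.pi * t : ℝ) * Complex.I))
  rw [Complex.norm_exp_ofReal_mul_I, norm_one] at h
  rw [← sub_eq_add_neg, norm_div, norm_div, Complex.norm_ofNat]
  nlinarith

lemma mask_ne_zero {t : ℝ} (h : ∀ z : ℤ, (z : ℝ) ≠ t) : mask t ≠ 0 := by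
  unfold mask
  rw [Ne, ENNReal.ofReal_eq_zero, not_le]
  refine pow_pos (norm_pos_iff.2 (div_ne_zero (fun h0 => ?_) two_ne_zero)) 2
  obtain ⟨z, hz⟩ := exists_int_of_exp_pi_mul_eq h0
  exact h z hz

lemma mask_mul_charFun (t : ℝ) (k : ℕ) :
    ENNReal.ofReal (‖charFun cantorMeasure (2 * Real.pi * (t + 4 * k))‖ ^ 2) =
      mask t * ENNReal.ofReal (‖charFun cantorMeasure (2 * Real.pi * (t / 4 + k))‖ ^ 2) := by
  have he := exp_pi_mul_add_two_mul t (2 * k)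
  rw [charFun_cantorMeasure, mask, ← ENNReal.ofReal_mul (by positivity), norm_mul, mul_pow]
  have h1 : t + 4 * (k : ℝ) = t + 2 * ((2 * k : ℕ) : ℝ) := by push_cast; ring
  have h2 : (t + 4 * (k : ℝ)) / 4 = t / 4 + k := by ring
  rw [h2, h1, he]

/-- Γ(m) contains 4Γ(m) and 4Γ(m) + m, disjoint by parity. On each piece the mask factor is
constant, because it has period 2, and comes out of the sum. -/
lemma mask_mul_parsevalSum_add_le {m : ℕ} (hm : Odd m) (t : ℝ) :
    mask t * parsevalSum m (t / 4) + mask (t + m) * parsevalSum m ((t + m) / 4) ≤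
      parsevalSum m t := by
  have hmem0 : ∀ x : digitSet m, 4 * (x : ℝ) ∈ digitSet m := fun x => by
    obtain ⟨k, hk, hx⟩ := mem_digitSet_iff.1 x.2
    exact mem_digitSet_iff.2 ⟨_, hk.four_mul, by rw [hx]; push_cast; ring⟩
  have hmem1 : ∀ x : digitSet m, 4 * (x : ℝ) + m ∈ digitSet m := fun x => by
    obtain ⟨k, hk, hx⟩ := mem_digitSet_iff.1 x.2
    exact mem_digitSet_iff.2 ⟨_, hk.four_mul_add, by rw [hx]; push_cast; ring⟩
  have hinj : Function.Injective
      (Sum.elim (fun x => ⟨_, hmem0 x⟩) (fun x => ⟨_, hmem1 x⟩) :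
        digitSet m ⊕ digitSet m → digitSet m) := by
    refine Function.Injective.sumElim ?_ ?_ ?_
    · intro x y h
      simp only [Subtype.mk.injEq] at h
      exact Subtype.ext (by linarith)
    · intro x y h
      simp only [Subtype.mk.injEq] at h
      exact Subtype.ext (by linarith)
    · intro x y h
      simp only [Subtype.mk.injEq] at h
      obtain ⟨i, -, hx⟩ := mem_digitSet_iff.1 x.2
      obtain ⟨j, -, hy⟩ := mem_digitSet_iff.1 y.2
      rw [hx, hy] at h
      have h' : 4 * i = 4 * j + m := by exact_mod_cast h
      obtain ⟨r, hr⟩ := hm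
      omega
  refine le_trans (le_of_eq ?_) (ENNReal.tsum_comp_le_tsum_of_injective hinj fun lam =>
    ENNReal.ofReal (‖charFun cantorMeasure (2 * Real.pi * (t + lam))‖ ^ 2))
  rw [Summable.tsum_sum ENNReal.summable ENNReal.summable, parsevalSum, parsevalSum,
    ← ENNReal.tsum_mul_left, ← ENNReal.tsum_mul_left]
  congr 1
  · refine tsum_congr fun x => ?_
    obtain ⟨k, -, hx⟩ := mem_digitSet_iff.1 x.2
    simp only [Sum.elim_inl]
    rw [hx, mask_mul_charFun]
  · refine tsum_congr fun x => ?_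
    obtain ⟨k, -, hx⟩ := mem_digitSet_iff.1 x.2
    simp only [Sum.elim_inr]
    rw [hx, ← mask_mul_charFun]
    congr 5
    ring

/-- Semicontinuity suffices for the minimum argument: minima on compact sets are attained and
sublevel sets are closed. -/
lemma lowerSemicontinuous_parsevalSum (m : ℕ) : LowerSemicontinuous (parsevalSum m) := by
  refine lowerSemicontinuous_tsum fun lam => Continuous.lowerSemicontinuous ?_
  have : Continuous (charFun cantorMeasure) := continuous_charFun
  exact ENNReal.continuous_ofReal.comp (by fun_prop)

lemma one_le_parsevalSum_zero (m : ℕ) : 1 ≤ parsevalSum m 0 := by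
  have h0 : (0 : ℝ) ∈ digitSet m := mem_digitSet_iff.2 ⟨0, .zero, by simp⟩
  refine le_trans (le_of_eq ?_) (ENNReal.le_tsum (⟨0, h0⟩ : digitSet m))
  simp

/-- A minimum of the Parseval sum is inherited by each child that has positive weight. -/
lemma parsevalSum_le_of_mask_ne_zero {m : ℕ} (hm : Odd m) {t : ℝ} {c : ℝ≥0∞} (hc : c ≠ ∞)
    (ht : parsevalSum m t ≤ c) (h0 : c ≤ parsevalSum m (t / 4))
    (h1 : c ≤ parsevalSum m ((t + m) / 4)) :
    (mask t ≠ 0 → parsevalSum m (t / 4) ≤ c) ∧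
      (mask (t + m) ≠ 0 → parsevalSum m ((t + m) / 4) ≤ c) := by
  have hsum := mask_add_mask hm t
  have hle := (mask_mul_parsevalSum_add_le hm t).trans ht
  have hf0 : mask t ≠ ∞ := ENNReal.ofReal_ne_top
  have hf1 : mask (t + m) ≠ ∞ := ENNReal.ofReal_ne_top
  -- An average of two values that are at least c exceeds c as soon as one of positive weight does;
  -- c must be finite for the strict inequality.
  have hc1 : mask t * c + mask (t + m) * c = c := by rw [← add_mul, hsum, one_mul]
  constructor
  · intro hw
    by_contra! hlt
    refine absurd hle (not_le.2 (hc1.symm.trans_lt ?_))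
    exact ENNReal.add_lt_add_of_lt_of_le (ENNReal.mul_ne_top hf1 hc)
      ((ENNReal.mul_lt_mul_iff_right hw hf0).2 hlt) (mul_le_mul_right h1 _)
  · intro hw
    by_contra! hlt
    refine absurd hle (not_le.2 (hc1.symm.trans_lt ?_))
    exact ENNReal.add_lt_add_of_le_of_lt (ENNReal.mul_ne_top hf0 hc) (mul_le_mul_right h0 _)
      ((ENNReal.mul_lt_mul_iff_right hw hf1).2 hlt)

/-! ### From a minimum below 1 to an integer orbit. -/

/-- A bounded nonempty set of nonzero integers, each of which has a child in the set, contains an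
infinite orbit of positive integers in `[0, m / 3]`. -/
lemma hasIntegerOrbit_of_forall_exists {m : ℕ} {Z : Set ℤ} (hne : Z.Nonempty) (hb : BddAbove Z)
    (h0 : (0 : ℤ) ∉ Z) (hZ : ∀ z ∈ Z, ∃ y ∈ Z, 4 * y = z ∨ 4 * y = z + m) : HasIntegerOrbit m := by
  obtain ⟨M, hM, hmax⟩ := Int.exists_greatest_of_bdd (P := (· ∈ Z))
    (let ⟨b, hb⟩ := hb; ⟨b, fun z hz => hb hz⟩) hne
  -- A negative integer has only children larger than itself, so the greatest element cannot be
  -- negative.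
  have hMpos : 0 < M := by
    by_contra! hneg
    have hM0 : M ≠ 0 := fun h => h0 (h ▸ hM)
    obtain ⟨y, hy, hy'⟩ := hZ M hM
    have := hmax y hy
    omega
  have hex : ∃ n : ℕ, 0 < n ∧ (n : ℤ) ∈ Z := ⟨M.toNat, by omega, by
    rwa [Int.toNat_of_nonneg hMpos.le]⟩
  have hchild : ∀ n : ℕ, 0 < n → (n : ℤ) ∈ Z →
      ∃ k : ℕ, 0 < k ∧ (k : ℤ) ∈ Z ∧ (4 * k = n ∨ 4 * k = n + m) := by
    intro n hn hnZ
    obtain ⟨y, hy, hy'⟩ := hZ n hnZ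
    lift y to ℕ using by omega
    exact ⟨y, by omega, hy, by omega⟩
  classical
  obtain ⟨hpos, hmem⟩ := Nat.find_spec hex
  have hmin := fun n hn => Nat.find_min' (m := n) hex hn
  set n₀ := Nat.find hex
  -- The child k of the least positive element satisfies n₀ ≤ k, so 4n₀ ≤ 4k ≤ n₀ + m. The bound m/3
  -- is then inherited by children.
  have h3 : 3 * n₀ ≤ m := by
    obtain ⟨k, hk, hkZ, hk'⟩ := hchild n₀ hpos hmem
    have := hmin k ⟨hk, hkZ⟩
    omega
  have hstep : ∀ n : {n : ℕ // 0 < n ∧ (n : ℤ) ∈ Z ∧ 3 * n ≤ m},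
      ∃ k : {n : ℕ // 0 < n ∧ (n : ℤ) ∈ Z ∧ 3 * n ≤ m},
        4 * (k : ℕ) = n ∨ 4 * (k : ℕ) = n + m := by
    rintro ⟨n, hn, hnZ, hn3⟩
    obtain ⟨k, hk, hkZ, hk'⟩ := hchild n hn hnZ
    exact ⟨⟨k, hk, hkZ, by omega⟩, hk'⟩
  choose f hf using hstep
  refine ⟨fun i => (f^[i] ⟨n₀, hpos, hmem, h3⟩).1, fun i => ⟨(f^[i] _).2.1, (f^[i] _).2.2.2, ?_⟩⟩
  simp only [Function.iterate_succ_apply']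
  exact hf _

lemma one_le_parsevalSum {m : ℕ} (hm : Odd m) (h : ¬ HasIntegerOrbit m) (t : ℝ) :
    1 ≤ parsevalSum m t := by
  by_contra! hlt
  -- A compact interval containing t and mapped into itself by both maps.
  set I : Set ℝ := Set.Icc (-|t|) (|t| + m) with hI
  have hm0 : (0 : ℝ) ≤ m := Nat.cast_nonneg m
  have htI : t ∈ I := ⟨neg_abs_le t, by linarith [le_abs_self t]⟩
  have hI0 : ∀ s ∈ I, s / 4 ∈ I := fun s hs =>
    ⟨by linarith [hs.1, abs_nonneg t], by linarith [hs.2, abs_nonneg t]⟩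
  have hI1 : ∀ s ∈ I, (s + m) / 4 ∈ I := fun s hs =>
    ⟨by linarith [hs.1, abs_nonneg t], by linarith [hs.2, abs_nonneg t]⟩
  obtain ⟨t₀, ht₀, hmin⟩ := ((lowerSemicontinuous_parsevalSum m).lowerSemicontinuousOn I).exists_isMinOn
    ⟨t, htI⟩ isCompact_Icc
  set c := parsevalSum m t₀
  have hmin' : ∀ s ∈ I, c ≤ parsevalSum m s := fun s hs => hmin hs
  have hc : c < 1 := (hmin' t htI).trans_lt hlt
  have hctop : c ≠ ∞ := (hc.trans ENNReal.one_lt_top).ne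
  have hnz : ¬ parsevalSum m 0 ≤ c := not_le.2 (hc.trans_le (one_le_parsevalSum_zero m))
  have hchild : ∀ s ∈ I, parsevalSum m s ≤ c →
      (mask s ≠ 0 → parsevalSum m (s / 4) ≤ c) ∧
        (mask (s + m) ≠ 0 → parsevalSum m ((s + m) / 4) ≤ c) := fun s hs hsc =>
    parsevalSum_le_of_mask_ne_zero hm hctop hsc (hmin' _ (hI0 s hs)) (hmin' _ (hI1 s hs))
  have hint : ∀ s ∈ I, parsevalSum m s ≤ c → ∃ z : ℤ, (z : ℝ) = s := by
    intro s hs hsc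
    by_contra! hns
    -- Dividing a non-integer by 4 never gives an integer, so the branch x/4 always has positive
    -- weight. The minimisers s/4^n then tend to 0, where the sum is at least 1.
    have hseq : ∀ n : ℕ, s / 4 ^ n ∈ I ∧ parsevalSum m (s / 4 ^ n) ≤ c := by
      intro n
      induction n with
      | zero => simpa using ⟨hs, hsc⟩
      | succ n ih =>
        have he : s / 4 ^ (n + 1) = s / 4 ^ n / 4 := by rw [pow_succ, div_div]
        rw [he]
        refine ⟨hI0 _ ih.1, (hchild _ ih.1 ih.2).1 (mask_ne_zero fun z hz => hns (4 ^ n * z) ?_)⟩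
        push_cast
        rw [hz]
        field_simp
    have hlim : Filter.Tendsto (fun n : ℕ => s / 4 ^ n) Filter.atTop (nhds 0) :=
      tendsto_const_nhds.div_atTop (tendsto_pow_atTop_atTop_of_one_lt (by norm_num))
    exact hnz (((lowerSemicontinuous_parsevalSum m).isClosed_preimage c).mem_of_tendsto hlim
      (Filter.Eventually.of_forall fun n => (hseq n).2))
  refine h (hasIntegerOrbit_of_forall_exists (Z := {z : ℤ | (z : ℝ) ∈ I ∧ parsevalSum m z ≤ c})
    ?_ ⟨⌈|t| + m⌉, fun z hz => ?_⟩ (fun hz => hnz (by simpa using hz.2)) ?_)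
  · obtain ⟨z, hz⟩ := hint t₀ ht₀ le_rfl
    exact ⟨z, by rwa [hz], by rw [hz]⟩
  · exact_mod_cast hz.1.2.trans (Int.le_ceil _)
  · rintro z ⟨hzI, hzc⟩
    by_cases hw : mask (z : ℝ) = 0
    · have hw1 : mask ((z : ℝ) + m) ≠ 0 := fun hw1 => by
        have := mask_add_mask hm z
        rw [hw, hw1, add_zero] at this
        exact zero_ne_one this
      have hle := (hchild z hzI hzc).2 hw1
      obtain ⟨y, hy⟩ := hint _ (hI1 _ hzI) hle
      refine ⟨y, ⟨hy ▸ hI1 _ hzI, hy ▸ hle⟩, Or.inr ?_⟩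
      have : (4 : ℝ) * y = z + m := by rw [hy]; ring
      exact_mod_cast this
    · have hle := (hchild z hzI hzc).1 hw
      obtain ⟨y, hy⟩ := hint _ (hI0 _ hzI) hle
      refine ⟨y, ⟨hy ▸ hI0 _ hzI, hy ▸ hle⟩, Or.inl ?_⟩
      have : (4 : ℝ) * y = z := by rw [hy]; ring
      exact_mod_cast this

/-- An odd number is complete if and only if it has no nontrivial integer orbit. -/
lemma isComplete_iff {m : ℕ} (hm : Odd m) : IsComplete m ↔ ¬ HasIntegerOrbit m :=
  ⟨fun hc h => h.not_isComplete hm hc,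
    fun h => isSpectrum_of_one_le_tsum (orthonormal_digitSet hm) (one_le_parsevalSum hm h)⟩

/-! Counting the points of an integer orbit. -/

section Orbit

variable {m : ℕ} {x : ℕ → ℕ}

lemma gcd_orbit_eq (hm : Odd m)
    (hx : ∀ i, 4 * x (i + 1) = x i ∨ 4 * x (i + 1) = x i + m) (i : ℕ) :
    (x i).gcd m = (x 0).gcd m := by
  induction i with
  | zero => rfl
  | succ i ih =>
    have h4 : Nat.Coprime 4 m := (Nat.Coprime.pow_left 2 (Nat.coprime_two_left.2 hm) :)
    rw [← ih, ← Nat.Coprime.gcd_mul_left_cancel (x (i + 1)) h4]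
    rcases hx i with h | h <;> rw [h]
    exact Nat.gcd_add_self_left _ _

lemma pow_mul_orbit (hx : ∀ i, 4 * x (i + 1) = x i ∨ 4 * x (i + 1) = x i + m) (i k : ℕ) :
    (4 : ZMod m) ^ k * x (i + k) = x i := by
  induction k with
  | zero => simp
  | succ k ih =>
    rw [pow_succ, mul_assoc, ← ih, ← add_assoc]
    congr 1
    rcases hx (i + k) with h | h
    · exact_mod_cast congrArg (Nat.cast : ℕ → ZMod m) h
    · simpa using congrArg (Nat.cast : ℕ → ZMod m) h

/-- A repetition at distance k gives 4^k u = u for a unit u mod m, so k is at least the order of 4.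
-/
lemma orbit_injOn (hx : ∀ i, 4 * x (i + 1) = x i ∨ 4 * x (i + 1) = x i + m)
    (hcop : ∀ i, (x i).Coprime m) (n : ℕ) :
    Set.InjOn (fun i => x (n + i)) (Finset.range (orderOf (4 : ZMod m))) := by
  have key : ∀ i j, i < j → j < orderOf (4 : ZMod m) → x (n + i) ≠ x (n + j) := by
    intro i j hij hj he
    have h1 := pow_mul_orbit hx (n + i) (j - i)
    rw [show n + i + (j - i) = n + j by omega, he] at h1
    have hu : IsUnit (x (n + j) : ZMod m) := (ZMod.isUnit_iff_coprime _ _).2 (hcop _)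
    have h2 : (4 : ZMod m) ^ (j - i) = 1 := hu.mul_right_cancel (by rw [h1, one_mul])
    exact absurd (orderOf_le_of_pow_eq_one (by omega) h2) (by omega)
  intro i hi j hj he
  rw [Finset.mem_coe, Finset.mem_range] at hi hj
  rcases lt_trichotomy i j with hij | hij | hij
  · exact absurd he (key i j hij hj)
  · exact hij
  · exact absurd he.symm (key j i hij hi)

/-- The natural numbers with `n` base 4 digits, all of them `0` or `1`. -/
def binaryDigitFinset : ℕ → Finset ℕ
  | 0 => {0}
  | n + 1 => binaryDigitFinset n ∪ (binaryDigitFinset n).image (4 ^ n + ·)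

lemma card_binaryDigitFinset_le (n : ℕ) : (binaryDigitFinset n).card ≤ 2 ^ n := by
  induction n with
  | zero => simp [binaryDigitFinset]
  | succ n ih =>
    refine (Finset.card_union_le _ _).trans ?_
    have := Finset.card_image_le (s := binaryDigitFinset n) (f := (4 ^ n + ·))
    rw [pow_succ]
    omega

lemma exists_pow_mul_orbit (hx : ∀ i, 4 * x (i + 1) = x i ∨ 4 * x (i + 1) = x i + m) (i n : ℕ) :
    ∃ a ∈ binaryDigitFinset n, 4 ^ n * x (n + i) = x i + m * a := by
  induction n with
  | zero => exact ⟨0, by simp [binaryDigitFinset], by simp⟩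
  | succ n ih =>
    obtain ⟨a, ha, he⟩ := ih
    have hs : n + 1 + i = n + i + 1 := by ring
    rcases hx (n + i) with h | h
    · refine ⟨a, Finset.mem_union_left _ ha, ?_⟩
      rw [hs, pow_succ, mul_assoc, h, he]
    · refine ⟨4 ^ n + a, Finset.mem_union_right _ (Finset.mem_image_of_mem _ ha), ?_⟩
      rw [hs, pow_succ, mul_assoc, h, mul_add, he]
      ring

/-- A half-open real interval of length `L` contains at most `⌈L⌉` natural numbers. -/
lemma card_le_ceil_of_forall_mem_Ioc {S : Finset ℕ} {a L : ℝ}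
    (hS : ∀ y ∈ S, (y : ℝ) ∈ Set.Ioc a (a + L)) :
    S.card ≤ ⌈L⌉₊ := by
  rcases S.eq_empty_or_nonempty with rfl | hne
  · simp
  set y₀ := S.min' hne
  have hy₀ := (hS y₀ (S.min'_mem hne)).1
  -- The open left end matters: the least element exceeds a, so a + L < y₀ + L.
  have hsub : S ⊆ Finset.Ico y₀ (y₀ + ⌈L⌉₊) := by
    intro y hy
    refine Finset.mem_Ico.2 ⟨S.min'_le y hy, ?_⟩
    have h1 := (hS y hy).2
    have h2 := Nat.le_ceil L
    have : (y : ℝ) < y₀ + ⌈L⌉₊ := by linarith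
    exact_mod_cast this
  simpa using Finset.card_le_card hsub

/-- From 4^n x_{n+i} = x_i + m a and 0 < x_i ≤ m/3, the point x_{n+i} lies in an interval of length
m/(3·4^n) starting at m a/4^n, with at most 2^n choices of a. -/
lemma orderOf_le_of_orbit
    (hx : ∀ i, 0 < x i ∧ 3 * x i ≤ m ∧ (4 * x (i + 1) = x i ∨ 4 * x (i + 1) = x i + m))
    (hcop : ∀ i, (x i).Coprime m) (n : ℕ) :
    orderOf (4 : ZMod m) ≤ 2 ^ n * ⌈(m : ℝ) / (3 * 4 ^ n)⌉₊ := by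
  classical
  set S := (Finset.range (orderOf (4 : ZMod m))).image fun i => x (n + i)
  have hcard : S.card = orderOf (4 : ZMod m) := by
    rw [Finset.card_image_of_injOn (orbit_injOn (fun i => (hx i).2.2) hcop n), Finset.card_range]
  have hcover : S ⊆ (binaryDigitFinset n).biUnion fun a =>
      S.filter fun y => (y : ℝ) ∈ Set.Ioc ((m : ℝ) * a / 4 ^ n) (m * a / 4 ^ n + m / (3 * 4 ^ n)) := by
    intro y hy
    obtain ⟨i, -, rfl⟩ := Finset.mem_image.1 hy
    obtain ⟨a, ha, he⟩ := exists_pow_mul_orbit (fun i => (hx i).2.2) i n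
    refine Finset.mem_biUnion.2 ⟨a, ha, Finset.mem_filter.2 ⟨hy, ?_⟩⟩
    have h4 : (0 : ℝ) < 4 ^ n := by positivity
    have he' : (4 : ℝ) ^ n * x (n + i) = x i + m * a := by exact_mod_cast he
    have hpos : (0 : ℝ) < x i := by exact_mod_cast (hx i).1
    have h3 : (3 : ℝ) * x i ≤ m := by exact_mod_cast (hx i).2.1
    constructor
    · rw [div_lt_iff₀ h4]
      linarith
    · have : (m : ℝ) * a / 4 ^ n + m / (3 * 4 ^ n) = (m * a + m / 3) / 4 ^ n := by
        field_simp
      rw [this, le_div_iff₀ h4]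
      linarith
  rw [← hcard]
  refine (Finset.card_le_card hcover).trans ((Finset.card_biUnion_le_card_mul _ _
    ⌈(m : ℝ) / (3 * 4 ^ n)⌉₊ fun a _ => ?_).trans
      (Nat.mul_le_mul_right _ (card_binaryDigitFinset_le n)))
  exact card_le_ceil_of_forall_mem_Ioc fun y hy => (Finset.mem_filter.1 hy).2

end Orbit

/-! ### Reduction to orbits coprime to m, and the conclusion. -/

lemma HasIntegerOrbit.orderOf_le {m : ℕ} (hm : Odd m) (h : HasIntegerOrbit m)
    (hd : ∀ d, d ∣ m → d < m → ¬ HasIntegerOrbit d) (n : ℕ) :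
    orderOf (4 : ZMod m) ≤ 2 ^ n * ⌈(m : ℝ) / (3 * 4 ^ n)⌉₊ := by
  obtain ⟨x, hx⟩ := h
  have hgcd := gcd_orbit_eq hm fun i => (hx i).2.2
  set g := (x 0).gcd m with hg
  have hgm : g ∣ m := Nat.gcd_dvd_right _ _
  have hg0 : 0 < g := Nat.gcd_pos_of_pos_right _ hm.pos
  -- The orbit relations and bounds are homogeneous, so dividing the orbit and m by g > 1 gives an
  -- orbit for the proper divisor m/g.
  have hg1 : g = 1 := by
    by_contra hne
    refine hd (m / g) (Nat.div_dvd_of_dvd hgm) (Nat.div_lt_self hm.pos (by omega)) ?_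
    have hdvd : ∀ i, g ∣ x i := fun i => hgcd i ▸ Nat.gcd_dvd_left _ _
    choose y hy using hdvd
    obtain ⟨r, hr⟩ := hgm
    have hr' : m / g = r := by rw [hr, Nat.mul_div_cancel_left _ hg0]
    refine ⟨y, fun i => ?_⟩
    rw [hr']
    obtain ⟨h1, h2, h3⟩ := hx i
    rw [hy i] at h1 h2 h3
    rw [hr, hy (i + 1)] at h3
    refine ⟨Nat.pos_of_mul_pos_left h1, ?_, ?_⟩
    · refine Nat.le_of_mul_le_mul_left ?_ hg0
      linarith
    · refine h3.imp (fun h3 => ?_) fun h3 => ?_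
      · exact Nat.eq_of_mul_eq_mul_left hg0 (by linarith)
      · exact Nat.eq_of_mul_eq_mul_left hg0 (by linarith)
  exact orderOf_le_of_orbit hx (fun i => (hgcd i).trans hg1) n

end CantorFour

theorem theorem3p12 (m : ℕ) (hm : Odd m)
    (h : (⨅ n : ℕ, 2 ^ n * ⌈(m : ℝ) / (3 * 4 ^ n)⌉₊) < orderOf (4 : ZMod m)) :
    ¬ CantorFour.IsPrimitive m ∧
      ((∀ d : ℕ, d ∣ m → d < m → CantorFour.IsComplete d) → CantorFour.IsComplete m) := by
  have key : (∀ d : ℕ, d ∣ m → d < m → CantorFour.IsComplete d) → CantorFour.IsComplete m := by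
    intro hd
    rw [CantorFour.isComplete_iff hm]
    intro ho
    obtain ⟨n, hn⟩ := exists_lt_of_ciInf_lt h
    refine absurd hn (not_lt.2 (ho.orderOf_le hm (fun d hdm hlt => ?_) n))
    exact (CantorFour.isComplete_iff (hm.of_dvd_nat hdm)).1 (hd d hdm hlt)
  exact ⟨fun hp => hp.2.1 (key hp.2.2), key⟩
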